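/- A *Banach lattice algebra* is a real Banach lattice $A$ that is also an associative (not necessarily unital) real Banach algebra with submultiplicative norm, in which the product of two positive elements is positive. It is an *AM-algebra* if there is a net $(e_\alpha)\subseteq A_+$ such that $x^*(e_\alpha)\to\|x^*\|$ for every positive $x^*\in A^*$, and $e_\alpha a\to a$ and $a e_\alpha\to a$ in norm for every $a\in A$. For an AM-algebra $X$, let $(B_X)_+=\{x\in X: x\ge 0,\ \|x\|\le 1\}$, let $K_X$ be the set of all lattice homomorphisms $x^*\in X^*$ with $\|x^*\|\le 1$, endowed with the weak$^*$ topology, and let $K_X^1=\{x^*\in K_X:\|x^*\|=1\}$. Let $C_{ph}(K_X)$ be the space of continuous functions $f:K_X\to\mathbb R$ such that $f(\lambda x^*)=\lambda f(x^*)$ whenever $\lambda\ge 0$ and $x^*,\lambda x^*\in K_X$. Identify $x\in X$ with the function $\mathrm{ev}_x\in C_{ph}(K_X)$, $\mathrm{ev}_x(x^*)=x^*(x)$. For a subset $B$ of an algebra put $B^2=\{b_1b_2: b_1,b_2\in B\}$. **Theorem.** Let $X$ and $Y$ be AM-algebras and let $T:X\to Y$ be a linear operator. The following are equivalent: 1.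 $T$ is an algebra homomorphism, i.e. $T(ab)=T(a)T(b)$ for all $a,b\in X$. 2. $T$ is a lattice homomorphism and, for every $y^*\in Y^*$, the limits below exist and $$\lim_{y\in T((B_X)_+)^2}y^*(y)=\lim_{y\in T((B_X)_+)}y^*(y),$$ where the sets $T((B_X)_+)^2$ and $T((B_X)_+)$ are regarded as nets indexed by themselves with the order of $Y$ (they are upward directed when $T$ is a lattice homomorphism). 3. There is a continuous map $\varphi:K_Y\to K_X$ with $\varphi(\lambda y^*)=\lambda\varphi(y^*)$ for all $y^*\in K_Y^1$ and $0\le\lambda\le1$, and with $\varphi(K_Y^1)\subseteq K_X^1\cup\{0\}$, such that $Tf=f\circ\varphi$ for all $f\in X$ under the identifications above; that is, $\mathrm{ev}_{Tx}=\mathrm{ev}_x\circ\varphi$ for every $x\in X$. -/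

import Mathlib

open Filter Topology

universe u v

/-- Banach lattice algebra: a real Banach lattice which is at the same time a (not necessarily
unital) real Banach algebra, and in which products of positive elements are positive. -/
class BanachLatticeAlgebra (A : Type u) [NonUnitalNormedRing A] [NormedSpace ℝ A] [Lattice A] :
    Prop extends CompleteSpace A, IsOrderedAddMonoid A, IsOrderedModule ℝ A, HasSolidNorm A,
      IsScalarTower ℝ A A, SMulCommClass ℝ A A where
  mul_nonneg' : ∀ a b : A, 0 ≤ a → 0 ≤ b → 0 ≤ a * b

/-- `e` is an approximate order unit: a net of positive elements such that `x*(e_i) → ‖x*‖` for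
every positive functional `x*`. -/
def IsApproxOrderUnit {A : Type u} [NormedAddCommGroup A] [NormedSpace ℝ A] [Lattice A]
    {ι : Type v} [Preorder ι] (e : ι → A) : Prop :=
  (∀ i, 0 ≤ e i) ∧
    ∀ f : StrongDual ℝ A, (∀ x : A, 0 ≤ x → 0 ≤ f x) →
      Tendsto (fun i => f (e i)) atTop (𝓝 ‖f‖)

/-- `e` is an approximate (algebraic, two-sided) identity. -/
def IsApproxIdentity {A : Type u} [NonUnitalNormedRing A] {ι : Type v} [Preorder ι]
    (e : ι → A) : Prop :=
  ∀ a : A, Tendsto (fun i => e i * a) atTop (𝓝 a) ∧ Tendsto (fun i => a * e i) atTop (𝓝 a)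

/-- `A`, with its product, is an AM-algebra: a Banach lattice algebra having a net that is both
an approximate order unit and an approximate identity. (Each net in `A` has the same convergence
properties as some net indexed by a directed set in the universe of `A`, namely the one attached
to its filter of tails, so restricting the universe of `ι` is harmless.) -/
class IsAMAlgebra (A : Type u) [NonUnitalNormedRing A] [NormedSpace ℝ A] [Lattice A] :
    Prop extends BanachLatticeAlgebra A where
  exists_approxUnit : ∃ (ι : Type u) (_ : Preorder ι) (_ : Nonempty ι)
    (_ : IsDirected ι (· ≤ ·)) (e : ι → A), IsApproxOrderUnit e ∧ IsApproxIdentity e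

/-- A map between lattices preserving `⊔` and `⊓`. (A lattice homomorphism of vector lattices is a
linear map with this property.) -/
def PreservesLattice {X : Type u} {Y : Type v} [Lattice X] [Lattice Y] (T : X → Y) : Prop :=
  ∀ a b : X, T (a ⊔ b) = T a ⊔ T b ∧ T (a ⊓ b) = T a ⊓ T b

/-- `(B_X)_+`: the positive part of the closed unit ball. -/
def posBall (X : Type u) [NormedAddCommGroup X] [Lattice X] : Set X :=
  {x | 0 ≤ x ∧ ‖x‖ ≤ 1}

/-- `B² = {b₁ b₂ : b₁, b₂ ∈ B}`. -/
def setSq {A : Type u} [Mul A] (B : Set A) : Set A :=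
  {z | ∃ b₁ ∈ B, ∃ b₂ ∈ B, z = b₁ * b₂}

/-- The set `B`, viewed as a net indexed by itself with the order of `A`: the limit of `f` along
this net exists and equals `l`. -/
def HasLimAlong {A : Type u} [Preorder A] (B : Set A) (f : A → ℝ) (l : ℝ) : Prop :=
  Tendsto (fun y : B => f y) atTop (𝓝 l)

section Spectrum

variable (X : Type u) [NormedAddCommGroup X] [NormedSpace ℝ X] [Lattice X]

/-- `K_X = hom(X, ℝ) ∩ B_{X*}`; as a subset of `WeakDual ℝ X` it carries the weak* topology. -/
def KSet : Set (WeakDual ℝ X) :=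
  {f | PreservesLattice (fun x : X => f x) ∧ ‖WeakDual.toStrongDual f‖ ≤ 1}

/-- `K_X¹ = hom(X, ℝ) ∩ S_{X*}`, as a subset of `K_X`. -/
def KOne : Set (KSet X) :=
  {f | ‖WeakDual.toStrongDual (f : WeakDual ℝ X)‖ = 1}

/-- The space of continuous positively homogeneous real functions on `K_X`. -/
def Cph : Submodule ℝ C(KSet X, ℝ) where
  carrier := {g | ∀ (f h : KSet X) (c : ℝ), 0 ≤ c →
    (h : WeakDual ℝ X) = c • (f : WeakDual ℝ X) → g h = c * g f}
  zero_mem' := by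
    intro f h c _ _
    simp
  add_mem' := by
    intro a b ha hb f h c hc hh
    simp only [ContinuousMap.add_apply, ha f h c hc hh, hb f h c hc hh]
    ring
  smul_mem' := by
    intro r a ha f h c hc hh
    simp only [ContinuousMap.smul_apply, ha f h c hc hh, smul_eq_mul]
    ring

variable {X}

/-- The canonical map `x ↦ ev_x`, `ev_x(x*) = x*(x)`, identifying `X` with `Cph X`. -/
noncomputable def ev : X →ₗ[ℝ] Cph X where
  toFun x := ⟨⟨fun f => (f : WeakDual ℝ X) x,
      (WeakDual.eval_continuous x).comp continuous_subtype_val⟩, by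
    intro f h c _ hh
    change (h : WeakDual ℝ X) x = c * (f : WeakDual ℝ X) x
    rw [hh]
    rfl⟩
  map_add' x y := by
    ext f
    exact map_add (f : WeakDual ℝ X) x y
  map_smul' c x := by
    ext f
    exact map_smul (f : WeakDual ℝ X) c x

/-- A map `φ : K_Y → K_X` is positively homogeneous if `φ(λ y*) = λ φ(y*)` for all `y* ∈ K_Y¹` and
`0 ≤ λ ≤ 1`. -/
def IsPosHomMap {Y : Type v} [NormedAddCommGroup Y] [NormedSpace ℝ Y] [Lattice Y]
    (φ : KSet Y → KSet X) : Prop :=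
  ∀ f ∈ KOne Y, ∀ c : ℝ, 0 ≤ c → c ≤ 1 → ∀ h : KSet Y,
    (h : WeakDual ℝ Y) = c • (f : WeakDual ℝ Y) →
      (φ h : WeakDual ℝ X) = c • (φ f : WeakDual ℝ X)

end Spectrum

set_option linter.unusedSectionVars false

/-! The engine is one identity: for a positive functional f and x ≥ 0, the functional z ↦ f(zx) has
norm exactly f(x). The net that is both approximate order unit and approximate identity computes the
norm as lim f(e_i x), and this limit is f(x) (`norm_mulRightDual`). Consequently ax ≤ ‖a‖x, so
disjoint elements have product zero and the positive unit ball is closed under a + b - ab, hence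
under suprema.

For b in that ball, f splits as f(· b) plus f - f(· b), both positive, with norms f(b) and ‖f‖ -
f(b). Extreme points of the positive dual ball are therefore multiplicative, and by Krein–Milman the
lattice homomorphisms of norm one separate points and are norming (`le_of_forall_latticeHom_le`).
These functionals are exactly the nonzero characters (`map_mul_of_preservesLattice`,
`nonneg_of_mul`).

The theorem is thus tested on χ = u ∘ T, with u a norm-one lattice homomorphism. If T is
multiplicative, χ is a character, so T is a contractive lattice homomorphism and φ is its adjoint
restricted to K_Y. Conversely, χ is multiplicative once it is a lattice homomorphism with ‖χ‖ ∈ {0,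
1}. Condition 3 states this through φ; in condition 2 the two limits of u are ‖χ‖² and ‖χ‖. -/

theorem PreservesLattice.nonneg {E : Type u} {F : Type v} [AddCommGroup E] [Module ℝ E] [Lattice E]
    [AddCommGroup F] [Module ℝ F] [Lattice F] {f : E →ₗ[ℝ] F} (hf : PreservesLattice f) (x : E)
    (hx : 0 ≤ x) : 0 ≤ f x := by
  have h := (hf x 0).1
  rw [sup_eq_left.2 hx, map_zero] at h
  exact h ▸ le_sup_right

theorem PreservesLattice.map_abs {E : Type u} {F : Type v} [AddCommGroup E] [Module ℝ E]
    [Lattice E] [AddCommGroup F] [Module ℝ F] [Lattice F] {f : E →ₗ[ℝ] F}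
    (hf : PreservesLattice f) (x : E) : f |x| = |f x| := by
  have h := (hf x (-x)).1
  rwa [map_neg] at h

/-! ### Positive functionals on a Banach lattice. -/

section BanachLattice

variable {E : Type*} [NormedAddCommGroup E] [Lattice E]
  [IsOrderedAddMonoid E]

theorem posPart_add_le_add (x y : E) : (x + y)⁺ ≤ x⁺ + y⁺ :=
  sup_le (add_le_add (le_posPart x) (le_posPart y)) (add_nonneg (posPart_nonneg x) (posPart_nonneg y))

theorem norm_le_norm_of_nonneg_of_le [HasSolidNorm E] {x y : E} (hx : 0 ≤ x) (hxy : x ≤ y) :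
    ‖x‖ ≤ ‖y‖ := by
  apply norm_le_norm_of_abs_le_abs
  rwa [abs_of_nonneg hx, abs_of_nonneg (hx.trans hxy)]

theorem norm_posPart_le [HasSolidNorm E] (x : E) : ‖x⁺‖ ≤ ‖x‖ := by
  rw [← norm_abs_eq_norm x]
  exact norm_le_norm_of_nonneg_of_le (posPart_nonneg x) (sup_le (le_abs_self x) (abs_nonneg x))

theorem norm_negPart_le [HasSolidNorm E] (x : E) : ‖x⁻‖ ≤ ‖x‖ := by
  rw [← posPart_neg, ← norm_neg x]
  exact norm_posPart_le (-x)

variable [NormedSpace ℝ E] [IsOrderedModule ℝ E]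

theorem posPart_smul_of_pos {c : ℝ} (hc : 0 < c) (x : E) : (c • x)⁺ = c • x⁺ := by
  have key : ∀ {c : ℝ}, 0 < c → ∀ x : E, (c • x)⁺ ≤ c • x⁺ := fun {c} hc x =>
    sup_le (smul_le_smul_of_nonneg_left (le_posPart x) hc.le) (smul_nonneg hc.le (posPart_nonneg x))
  refine le_antisymm (key hc x) ?_
  have h := smul_le_smul_of_nonneg_left (key (inv_pos.2 hc) (c • x)) hc.le
  rwa [inv_smul_smul₀ hc.ne', smul_inv_smul₀ hc.ne'] at h

variable [HasSolidNorm E]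

/-- Every element has a positive functional in the dual unit ball attaining the norm of its
positive part. -/
theorem exists_positive_functional (y : E) :
    ∃ f : StrongDual ℝ E, (∀ x, 0 ≤ x → 0 ≤ f x) ∧ ‖f‖ ≤ 1 ∧ f y = ‖y⁺‖ := by
  rcases eq_or_ne y 0 with rfl | hy
  · exact ⟨0, by simp, by simp, by simp⟩
  have hsmul : ∀ c : ℝ, 0 < c → ∀ x : E, ‖(c • x)⁺‖ = c * ‖x⁺‖ := fun c hc x => by
    rw [posPart_smul_of_pos hc, norm_smul, Real.norm_of_nonneg hc.le]
  have hadd : ∀ x z : E, ‖(x + z)⁺‖ ≤ ‖x⁺‖ + ‖z⁺‖ := fun x z =>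
    (norm_le_norm_of_nonneg_of_le (posPart_nonneg _) (posPart_add_le_add x z)).trans
      (norm_add_le _ _)
  -- Hahn–Banach under the sublinear majorant x ↦ ‖x⁺‖. It vanishes on the negative cone, which
  -- makes the extension positive.
  obtain ⟨g, hg, hgle⟩ := exists_extension_of_le_sublinear
    (LinearPMap.mkSpanSingleton (σ := RingHom.id ℝ) y ‖y⁺‖ hy) (fun x => ‖x⁺‖) hsmul hadd (by
      rintro ⟨x, hx⟩
      obtain ⟨c, rfl⟩ := Submodule.mem_span_singleton.1 hx
      rw [LinearPMap.mkSpanSingleton'_apply]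
      simp only [RingHom.id_apply, smul_eq_mul]
      rcases lt_or_ge 0 c with hc | hc
      · exact (hsmul c hc y).ge
      · exact (mul_nonpos_of_nonpos_of_nonneg hc (norm_nonneg _)).trans (norm_nonneg _))
  have hgn : ∀ x, ‖g x‖ ≤ 1 * ‖x‖ := fun x => by
    rw [one_mul, Real.norm_eq_abs, abs_le]
    have h1 := (hgle x).trans (norm_posPart_le x)
    have h2 := (hgle (-x)).trans (norm_posPart_le (-x))
    rw [map_neg, norm_neg] at h2
    exact ⟨by linarith, h1⟩
  refine ⟨g.mkContinuous 1 hgn, fun x hx => ?_, g.mkContinuous_norm_le zero_le_one hgn, ?_⟩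
  · have h := hgle (-x)
    rw [map_neg, posPart_eq_zero.2 (neg_nonpos.2 hx), norm_zero] at h
    exact neg_nonpos.1 h
  · have h := hg ⟨y, Submodule.mem_span_singleton_self y⟩
    rwa [LinearPMap.mkSpanSingleton_apply] at h

theorem nonneg_of_forall_positive {y : E}
    (h : ∀ f : StrongDual ℝ E, (∀ x, 0 ≤ x → 0 ≤ f x) → 0 ≤ f y) : 0 ≤ y := by
  obtain ⟨f, hf, -, hfy⟩ := exists_positive_functional (-y)
  have h1 := h f hf
  rw [map_neg] at hfy
  have h2 : ‖(-y)⁺‖ = 0 := le_antisymm (by linarith) (norm_nonneg _)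
  exact neg_nonpos.1 (posPart_eq_zero.1 (norm_eq_zero.1 h2))

theorem norm_le_of_forall_positive {y : E} {c : ℝ} (hy : 0 ≤ y)
    (h : ∀ f : StrongDual ℝ E, (∀ x, 0 ≤ x → 0 ≤ f x) → ‖f‖ ≤ 1 → f y ≤ c) : ‖y‖ ≤ c := by
  obtain ⟨f, hf, hf1, hfy⟩ := exists_positive_functional y
  rw [posPart_eq_self.2 hy] at hfy
  exact hfy ▸ h f hf hf1

theorem abs_apply_le_of_positive {f : E →ₗ[ℝ] ℝ} (hf : ∀ x, 0 ≤ x → 0 ≤ f x) (x : E) :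
    |f x| ≤ f |x| := by
  have h1 := hf _ (sub_nonneg.2 (le_abs_self x))
  have h2 := hf _ (sub_nonneg.2 (neg_le_abs x))
  rw [map_sub] at h1 h2
  rw [map_neg] at h2
  exact abs_le.2 ⟨by linarith, by linarith⟩

theorem opNorm_le_of_positive {f : StrongDual ℝ E} (hf : ∀ x, 0 ≤ x → 0 ≤ f x) {c : ℝ}
    (hc : 0 ≤ c) (h : ∀ x, 0 ≤ x → f x ≤ c * ‖x‖) : ‖f‖ ≤ c := by
  refine f.opNorm_le_bound hc fun x => ?_
  rw [← norm_abs_eq_norm x]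
  exact (abs_apply_le_of_positive (f := (f : E →ₗ[ℝ] ℝ)) hf x).trans (h _ (abs_nonneg x))

theorem map_mono_of_positive {f : E →ₗ[ℝ] ℝ} (hf : ∀ x, 0 ≤ x → 0 ≤ f x) {x y : E}
    (h : x ≤ y) : f x ≤ f y := by
  have := hf _ (sub_nonneg.2 h)
  rw [map_sub] at this
  linarith

/-- The norm of a positive functional is its supremum over the positive part of the unit ball. -/
theorem isLUB_image_posBall {f : StrongDual ℝ E} (hf : ∀ x, 0 ≤ x → 0 ≤ f x) :
    IsLUB (f '' posBall E) ‖f‖ := by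
  constructor
  · rintro _ ⟨x, hx, rfl⟩
    exact (le_abs_self _).trans ((f.le_opNorm x).trans
      (mul_le_of_le_one_right (norm_nonneg _) hx.2))
  · intro c hc
    have hc0 : 0 ≤ c := hc ⟨0, ⟨le_rfl, by simp⟩, map_zero f⟩
    refine opNorm_le_of_positive hf hc0 fun x hx => ?_
    rcases eq_or_ne x 0 with rfl | hx0
    · simp
    have hn : 0 < ‖x‖ := norm_pos_iff.2 hx0
    have h := hc ⟨‖x‖⁻¹ • x, ⟨smul_nonneg (inv_nonneg.2 hn.le) hx, by
      rw [norm_smul, norm_inv, norm_norm, inv_mul_cancel₀ hn.ne']⟩, rfl⟩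
    rw [map_smul, smul_eq_mul, inv_mul_le_iff₀ hn] at h
    linarith

/-- A linear map preserving absolute values is a lattice homomorphism. -/
theorem preservesLattice_of_map_abs {F : Type*} [AddCommGroup F] [Lattice F]
    [IsOrderedAddMonoid F] [Module ℝ F] (f : E →ₗ[ℝ] F) (hf : ∀ x, f |x| = |f x|) :
    ∀ a b : E, f (a ⊔ b) = f a ⊔ f b ∧ f (a ⊓ b) = f a ⊓ f b := fun a b => by
  rw [sup_eq_half_smul_add_add_abs_sub ℝ, sup_eq_half_smul_add_add_abs_sub ℝ,
    inf_eq_half_smul_add_sub_abs_sub ℝ, inf_eq_half_smul_add_sub_abs_sub ℝ]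
  simp only [map_smul, map_add, map_sub, hf, and_self]

end BanachLattice

/-! ### Order and product in an AM-algebra. -/

section AMAlgebra

variable {A : Type u} [NonUnitalNormedRing A] [NormedSpace ℝ A] [Lattice A] [IsAMAlgebra A]

theorem amAlgebra_mul_nonneg {a b : A} (ha : 0 ≤ a) (hb : 0 ≤ b) : 0 ≤ a * b :=
  BanachLatticeAlgebra.mul_nonneg' a b ha hb

theorem amAlgebra_mul_le_mul {a b c d : A} (hab : a ≤ b) (hcd : c ≤ d) (hc : 0 ≤ c)
    (hb : 0 ≤ b) : a * c ≤ b * d := by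
  have h1 := amAlgebra_mul_nonneg (sub_nonneg.2 hab) hc
  have h2 := amAlgebra_mul_nonneg hb (sub_nonneg.2 hcd)
  rw [sub_mul, sub_nonneg] at h1
  rw [mul_sub, sub_nonneg] at h2
  exact h1.trans h2

/-- The functional `z ↦ f (z * x)`. -/
noncomputable def mulRightDual (f : StrongDual ℝ A) (x : A) : StrongDual ℝ A :=
  f.comp ((ContinuousLinearMap.mul ℝ A).flip x)

/-- The functional `z ↦ f (x * z)`. -/
noncomputable def mulLeftDual (f : StrongDual ℝ A) (x : A) : StrongDual ℝ A :=
  f.comp (ContinuousLinearMap.mul ℝ A x)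

@[simp] theorem mulRightDual_apply (f : StrongDual ℝ A) (x z : A) :
    mulRightDual f x z = f (z * x) := rfl

@[simp] theorem mulLeftDual_apply (f : StrongDual ℝ A) (x z : A) :
    mulLeftDual f x z = f (x * z) := rfl

variable {f : StrongDual ℝ A}

theorem mulRightDual_positive (hf : ∀ x, 0 ≤ x → 0 ≤ f x) {x : A} (hx : 0 ≤ x) (z : A)
    (hz : 0 ≤ z) : 0 ≤ mulRightDual f x z :=
  hf _ (amAlgebra_mul_nonneg hz hx)

/-- Along the net, f(e_i x) tends to the norm by the order-unit property and to f(x) by the identity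
property. -/
theorem norm_mulRightDual (hf : ∀ x, 0 ≤ x → 0 ≤ f x) {x : A} (hx : 0 ≤ x) :
    ‖mulRightDual f x‖ = f x := by
  obtain ⟨ι, _, _, _, e, he, hid⟩ := IsAMAlgebra.exists_approxUnit (A := A)
  exact tendsto_nhds_unique (he.2 _ (mulRightDual_positive hf hx))
    ((f.continuous.tendsto x).comp (hid x).1)

theorem norm_mulLeftDual (hf : ∀ x, 0 ≤ x → 0 ≤ f x) {x : A} (hx : 0 ≤ x) :
    ‖mulLeftDual f x‖ = f x := by
  obtain ⟨ι, _, _, _, e, he, hid⟩ := IsAMAlgebra.exists_approxUnit (A := A)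
  exact tendsto_nhds_unique (he.2 (mulLeftDual f x) fun z hz => hf _ (amAlgebra_mul_nonneg hx hz))
    ((f.continuous.tendsto x).comp (hid x).2)

theorem mul_le_norm_smul_right (a : A) {x : A} (hx : 0 ≤ x) : a * x ≤ ‖a‖ • x := by
  refine sub_nonneg.1 (nonneg_of_forall_positive fun f hf => ?_)
  have h := (le_abs_self _).trans ((mulRightDual f x).le_opNorm a)
  rw [norm_mulRightDual hf hx, mulRightDual_apply] at h
  rw [map_sub, map_smul, smul_eq_mul]
  linarith

theorem mul_le_norm_smul_left (a : A) {x : A} (hx : 0 ≤ x) : x * a ≤ ‖a‖ • x := by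
  refine sub_nonneg.1 (nonneg_of_forall_positive fun f hf => ?_)
  have h := (le_abs_self _).trans ((mulLeftDual f x).le_opNorm a)
  rw [norm_mulLeftDual hf hx, mulLeftDual_apply] at h
  rw [map_sub, map_smul, smul_eq_mul]
  linarith

theorem mul_le_right_of_mem_posBall {a x : A} (ha : a ∈ posBall A) (hx : 0 ≤ x) : a * x ≤ x :=
  (mul_le_norm_smul_right a hx).trans (smul_le_of_le_one_left hx ha.2)

theorem mul_le_left_of_mem_posBall {a x : A} (ha : a ∈ posBall A) (hx : 0 ≤ x) : x * a ≤ x :=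
  (mul_le_norm_smul_left a hx).trans (smul_le_of_le_one_left hx ha.2)

theorem sub_mulRightDual_positive (hf : ∀ x, 0 ≤ x → 0 ≤ f x) {b : A} (hb : b ∈ posBall A)
    (z : A) (hz : 0 ≤ z) : 0 ≤ (f - mulRightDual f b) z := by
  have := hf _ (sub_nonneg.2 (mul_le_left_of_mem_posBall hb hz))
  rwa [map_sub] at this

/-- The same net evaluates this norm, so the norms of the two summands of f = f(· b) + (f - f(· b))
add up to ‖f‖. -/
theorem norm_sub_mulRightDual (hf : ∀ x, 0 ≤ x → 0 ≤ f x) {b : A} (hb : b ∈ posBall A) :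
    ‖f - mulRightDual f b‖ = ‖f‖ - f b := by
  obtain ⟨ι, _, _, _, e, he, hid⟩ := IsAMAlgebra.exists_approxUnit (A := A)
  exact tendsto_nhds_unique (he.2 _ (sub_mulRightDual_positive hf hb))
    ((he.2 f hf).sub ((f.continuous.tendsto b).comp (hid b).1))

/-- The positive part of the unit ball is closed under the circle operation `a + b - a * b`. -/
theorem add_sub_mul_mem_posBall {a b : A} (ha : a ∈ posBall A) (hb : b ∈ posBall A) :
    a + b - a * b ∈ posBall A := by
  have h0 : 0 ≤ a + b - a * b := by
    rw [add_sub_assoc]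
    exact add_nonneg ha.1 (sub_nonneg.2 (mul_le_right_of_mem_posBall ha hb.1))
  refine ⟨h0, norm_le_of_forall_positive h0 fun f hf hf1 => ?_⟩
  -- Write f(a + b - ab) = (f - f(· b))(a) + f(b), which is at most (‖f‖ - f(b)) + f(b).
  have h := (le_abs_self _).trans ((f - mulRightDual f b).le_opNorm a)
  rw [norm_sub_mulRightDual hf hb, sub_apply, mulRightDual_apply] at h
  have h2 : f b ≤ ‖f‖ := (isLUB_image_posBall hf).1 ⟨b, hb, rfl⟩
  have h3 := mul_le_of_le_one_right (sub_nonneg.2 h2) ha.2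
  rw [map_sub, map_add]
  linarith

theorem sup_mem_posBall {a b : A} (ha : a ∈ posBall A) (hb : b ∈ posBall A) :
    a ⊔ b ∈ posBall A := by
  have h0 : 0 ≤ a ⊔ b := ha.1.trans le_sup_left
  refine ⟨h0, (norm_le_norm_of_nonneg_of_le h0 (sup_le ?_ ?_)).trans
    (add_sub_mul_mem_posBall ha hb).2⟩
  · rw [add_sub_assoc]
    exact le_add_of_nonneg_right (sub_nonneg.2 (mul_le_right_of_mem_posBall ha hb.1))
  · rw [add_sub_right_comm]
    exact le_add_of_nonneg_left (sub_nonneg.2 (mul_le_left_of_mem_posBall hb ha.1))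

theorem mul_mem_posBall {a b : A} (ha : a ∈ posBall A) (hb : b ∈ posBall A) :
    a * b ∈ posBall A :=
  ⟨amAlgebra_mul_nonneg ha.1 hb.1,
    (norm_mul_le a b).trans (mul_le_one₀ ha.2 (norm_nonneg b) hb.2)⟩

/-- The product lies below a common multiple of `a` and of `b`, hence below a multiple of a ⊓ b. -/
theorem mul_eq_zero_of_inf_eq_zero {a b : A} (hab : a ⊓ b = 0) : a * b = 0 := by
  have ha : 0 ≤ a := hab ▸ inf_le_left
  have hb : 0 ≤ b := hab ▸ inf_le_right
  set c : ℝ := ‖a‖ + ‖b‖ + 1 with hc_def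
  have hc : 0 < c := by positivity
  have h1 : a * b ≤ c • b := (mul_le_norm_smul_right a hb).trans
    (smul_le_smul_of_nonneg_right (by linarith [norm_nonneg b]) hb)
  have h2 : a * b ≤ c • a := (mul_le_norm_smul_left b ha).trans
    (smul_le_smul_of_nonneg_right (by linarith [norm_nonneg a]) ha)
  have h3 : c⁻¹ • (a * b) ≤ a ⊓ b :=
    le_inf ((inv_smul_le_iff_of_pos hc).2 h2) ((inv_smul_le_iff_of_pos hc).2 h1)
  rw [hab, inv_smul_le_iff_of_pos hc, smul_zero] at h3
  exact le_antisymm h3 (amAlgebra_mul_nonneg ha hb)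

/-- A positive multiplicative functional is a lattice homomorphism. -/
theorem preservesLattice_of_positive_of_mul {f : A →ₗ[ℝ] ℝ} (hf : ∀ x, 0 ≤ x → 0 ≤ f x)
    (hmul : ∀ a b, f (a * b) = f a * f b) : PreservesLattice f := by
  refine preservesLattice_of_map_abs f fun x => ?_
  have h0 : f x⁺ * f x⁻ = 0 := by
    rw [← hmul, mul_eq_zero_of_inf_eq_zero (posPart_inf_negPart_eq_zero x), map_zero]
  have h1 : f x = f x⁺ - f x⁻ := by rw [← map_sub, posPart_sub_negPart]
  rw [← posPart_add_negPart x, map_add, h1]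
  rcases mul_eq_zero.1 h0 with h | h <;> rw [h]
  · simp [abs_of_nonneg (hf _ (negPart_nonneg x))]
  · simp [abs_of_nonneg (hf _ (posPart_nonneg x))]

/-- By multiplicativity f(· x) = f(x) f; comparing norms gives f(x)‖f‖ = f(x). -/
theorem norm_eq_zero_or_one_of_positive_of_mul (hf : ∀ x, 0 ≤ x → 0 ≤ f x)
    (hmul : ∀ a b, f (a * b) = f a * f b) : f = 0 ∨ ‖f‖ = 1 := by
  by_cases h : ∀ x, 0 ≤ x → f x = 0
  · left
    ext x
    rw [← posPart_sub_negPart x, map_sub, h _ (posPart_nonneg x), h _ (negPart_nonneg x)]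
    simp
  · right
    push Not at h
    obtain ⟨x, hx, hfx⟩ := h
    have h1 : mulRightDual f x = f x • f := by
      ext z
      simp [hmul, mul_comm]
    have h2 := norm_mulRightDual hf hx
    rw [h1, norm_smul, Real.norm_of_nonneg (hf x hx)] at h2
    exact mul_left_cancel₀ hfx (by rw [h2, mul_one])

/-- A lattice homomorphism of norm one is multiplicative. -/
theorem map_mul_of_preservesLattice (hf : PreservesLattice f) (hf1 : ‖f‖ = 1) (a b : A) :
    f (a * b) = f a * f b := by
  have hpos : ∀ x, 0 ≤ x → 0 ≤ f x := PreservesLattice.nonneg (f := (f : A →ₗ[ℝ] ℝ)) hf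
  have key : ∀ x, 0 ≤ x → ∀ z, f (z * x) = f z * f x := by
    intro x hx
    -- Since |f(zx)| ≤ f(|z|x) ≤ ‖x‖ f(|z|) = ‖x‖ |f(z)|, the kernel of `f` lies in that of f(· x),
    -- which is then a multiple of `f`. The norm identity gives the scalar up to sign, positivity
    -- the sign.
    have hker : ∀ z, f z = 0 → f (z * x) = 0 := by
      intro z hz
      have h1 : f |z| = 0 := by
        have := PreservesLattice.map_abs (f := (f : A →ₗ[ℝ] ℝ)) hf z
        simpa [hz] using this
      have h2 := map_mono_of_positive (f := (f : A →ₗ[ℝ] ℝ)) hpos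
        (mul_le_norm_smul_left x (abs_nonneg z))
      have h3 := abs_apply_le_of_positive (f := (mulRightDual f x : A →ₗ[ℝ] ℝ))
        (mulRightDual_positive hpos hx) z
      simp only [ContinuousLinearMap.coe_coe, map_smul, h1, smul_zero, mulRightDual_apply] at h2 h3
      exact abs_nonpos_iff.1 (h3.trans h2)
    obtain ⟨w, hw⟩ : ∃ w, f w ≠ 0 := by
      by_contra! h
      have : f = 0 := by ext z; exact h z
      simp [this] at hf1
    have hprop : mulRightDual f x = (f (w * x) / f w) • f := by
      ext z
      have h := hker (z - (f z / f w) • w) (by simp [hw])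
      rw [sub_mul, map_sub, smul_mul_assoc, map_smul, sub_eq_zero] at h
      rw [mulRightDual_apply, h]
      simp only [smul_apply, smul_eq_mul]
      ring
    set c := f (w * x) / f w
    have hn := norm_mulRightDual hpos hx
    rw [hprop, norm_smul, hf1, mul_one] at hn
    have hc : c = f x := by
      obtain ⟨v, hv, hv0⟩ : ∃ v, 0 ≤ v ∧ 0 < f v := by
        refine ⟨|w|, abs_nonneg w, ?_⟩
        have := PreservesLattice.map_abs (f := (f : A →ₗ[ℝ] ℝ)) hf w
        simp only [ContinuousLinearMap.coe_coe] at this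
        rw [this]
        exact abs_pos.2 hw
      have h := mulRightDual_positive hpos hx v hv
      rw [hprop] at h
      rw [← hn, Real.norm_of_nonneg (nonneg_of_mul_nonneg_left h hv0)]
    intro z
    rw [← mulRightDual_apply, hprop, hc]
    simp [mul_comm]
  conv_lhs => rw [← posPart_sub_negPart b]
  rw [mul_sub, map_sub, key _ (posPart_nonneg b), key _ (negPart_nonneg b), ← mul_sub, ← map_sub,
    posPart_sub_negPart]

end AMAlgebra

/-! ### Jordan decomposition of continuous functionals. -/

section PositiveDecomposition

variable {E : Type*} [NormedAddCommGroup E] [NormedSpace ℝ E] [Lattice E]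
  [IsOrderedAddMonoid E] [IsOrderedModule ℝ E] [HasSolidNorm E]

/-- A bounded additive function on the positive cone extends to a continuous functional. -/
theorem exists_dual_of_additive_on_cone (P : E → ℝ) (C : ℝ)
    (hadd : ∀ x y, 0 ≤ x → 0 ≤ y → P (x + y) = P x + P y)
    (hC : ∀ x, 0 ≤ x → |P x| ≤ C * ‖x‖) : ∃ f : StrongDual ℝ E, ∀ x, 0 ≤ x → f x = P x := by
  have h0 : P 0 = 0 := by simpa using hadd 0 0 le_rfl le_rfl
  let F : E →+ ℝ :=
    { toFun := fun x => P x⁺ - P x⁻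
      map_zero' := by simp
      map_add' := fun x y => by
        have h : (x + y)⁺ + (x⁻ + y⁻) = (x + y)⁻ + (x⁺ + y⁺) := by
          have h1 := posPart_sub_negPart (x + y)
          have h2 := posPart_sub_negPart x
          have h3 := posPart_sub_negPart y
          rw [← sub_eq_zero]
          calc _ = ((x + y)⁺ - (x + y)⁻) - ((x⁺ - x⁻) + (y⁺ - y⁻)) := by abel
            _ = 0 := by rw [h1, h2, h3, sub_self]
        have hP := congrArg P h
        have px := posPart_nonneg x
        have py := posPart_nonneg y
        have nx := negPart_nonneg x
        have ny := negPart_nonneg y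
        rw [hadd _ _ (posPart_nonneg _) (add_nonneg nx ny), hadd _ _ nx ny,
          hadd _ _ (negPart_nonneg _) (add_nonneg px py), hadd _ _ px py] at hP
        linarith }
  have hC0 : ∀ x : E, 0 ≤ x → |P x| ≤ |C| * ‖x‖ := fun x hx =>
    (hC x hx).trans (mul_le_mul_of_nonneg_right (le_abs_self C) (norm_nonneg x))
  have hF : ∀ x, ‖F x‖ ≤ (2 * |C|) * ‖x‖ := fun x => by
    have h1 : ‖F x‖ ≤ |P x⁺| + |P x⁻| := abs_sub _ _
    have h2 := hC0 _ (posPart_nonneg x)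
    have h3 := hC0 _ (negPart_nonneg x)
    have h4 := mul_le_mul_of_nonneg_left (norm_posPart_le x) (abs_nonneg C)
    have h5 := mul_le_mul_of_nonneg_left (norm_negPart_le x) (abs_nonneg C)
    linarith
  refine ⟨F.toRealLinearMap (AddMonoidHomClass.continuous_of_bound F _ hF), fun x hx => ?_⟩
  change P x⁺ - P x⁻ = P x
  rw [posPart_eq_self.2 hx, negPart_eq_zero.2 hx, h0, sub_zero]

/-- Every continuous functional on a normed lattice is a difference of positive ones. -/
theorem exists_positive_sub_positive (g : StrongDual ℝ E) :
    ∃ g₁ g₂ : StrongDual ℝ E, (∀ x, 0 ≤ x → 0 ≤ g₁ x) ∧ (∀ x, 0 ≤ x → 0 ≤ g₂ x) ∧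
      g = g₁ - g₂ := by
  have hub : ∀ x, ∀ r ∈ g '' Set.Icc 0 x, r ≤ ‖g‖ * ‖x‖ := by
    rintro x _ ⟨z, hz, rfl⟩
    exact (le_abs_self _).trans ((g.le_opNorm z).trans
      (mul_le_mul_of_nonneg_left (norm_le_norm_of_nonneg_of_le hz.1 hz.2) (norm_nonneg g)))
  have hbdd : ∀ x, BddAbove (g '' Set.Icc 0 x) := fun x => ⟨_, hub x⟩
  -- Riesz–Kantorovich formula for the positive part of `g`.
  set P : E → ℝ := fun x => sSup (g '' Set.Icc 0 x) with hP
  have hle : ∀ x z, 0 ≤ z → z ≤ x → g z ≤ P x := fun x z h0 h1 =>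
    le_csSup (hbdd x) ⟨z, ⟨h0, h1⟩, rfl⟩
  have hPle : ∀ x, 0 ≤ x → ∀ c, (∀ z, 0 ≤ z → z ≤ x → g z ≤ c) → P x ≤ c := fun x hx c hc =>
    csSup_le ⟨g 0, 0, ⟨le_rfl, hx⟩, rfl⟩ (by rintro _ ⟨z, hz, rfl⟩; exact hc z hz.1 hz.2)
  have hP0 : ∀ x, 0 ≤ x → 0 ≤ P x := fun x hx => by simpa using hle x 0 le_rfl hx
  obtain ⟨f, hf⟩ := exists_dual_of_additive_on_cone P ‖g‖ (fun x y hx hy => by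
      apply le_antisymm
      · refine hPle _ (add_nonneg hx hy) _ fun z hz hzxy => ?_
        -- Riesz decomposition of z ≤ x + y into z ⊓ x and z - z ⊓ x ≤ y.
        have h1 := hle x (z ⊓ x) (le_inf hz hx) inf_le_right
        have h2 := hle y (z - z ⊓ x) (sub_nonneg.2 inf_le_left) (by
          rw [sub_le_iff_le_add, add_comm y, inf_add]
          exact le_inf (le_add_of_nonneg_right hy) hzxy)
        rw [map_sub] at h2
        linarith
      · have h : P x ≤ P (x + y) - P y := hPle x hx _ fun z hz hzx => by
          have h : P y ≤ P (x + y) - g z := hPle y hy _ fun w hw hwy => by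
            have := hle (x + y) (z + w) (add_nonneg hz hw) (add_le_add hzx hwy)
            rw [map_add] at this
            linarith
          linarith
        linarith)
    (fun x hx => by
      rw [abs_of_nonneg (hP0 x hx)]
      exact hPle x hx _ fun z hz hzx => hub x _ ⟨z, ⟨hz, hzx⟩, rfl⟩)
  refine ⟨f, f - g, fun x hx => hf x hx ▸ hP0 x hx, fun x hx => ?_, by abel⟩
  change 0 ≤ f x - g x
  rw [hf x hx, sub_nonneg]
  exact hle x x hx le_rfl

end PositiveDecomposition

/-! ### Extreme positive functionals and Krein–Milman. -/

section PositiveStates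

variable {A : Type u} [NonUnitalNormedRing A] [NormedSpace ℝ A] [Lattice A] [IsAMAlgebra A]

/-- The positive part of the dual unit ball. -/
def positiveDualBall (A : Type u) [NonUnitalNormedRing A] [NormedSpace ℝ A] [Lattice A] :
    Set (WeakDual ℝ A) :=
  {f | (∀ x : A, 0 ≤ x → 0 ≤ f x) ∧ ‖WeakDual.toStrongDual f‖ ≤ 1}

theorem convex_positiveDualBall : Convex ℝ (positiveDualBall A) := by
  rintro f ⟨hf, hf1⟩ g ⟨hg, hg1⟩ s t hs ht hst
  refine ⟨fun x hx => add_nonneg (mul_nonneg hs (hf x hx)) (mul_nonneg ht (hg x hx)), ?_⟩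
  have h := convex_closedBall (0 : StrongDual ℝ A) 1 (mem_closedBall_zero_iff.2 hf1)
    (mem_closedBall_zero_iff.2 hg1) hs ht hst
  exact mem_closedBall_zero_iff.1 h

theorem isCompact_positiveDualBall : IsCompact (positiveDualBall A) := by
  have h : positiveDualBall A = {f | ∀ x : A, 0 ≤ x → 0 ≤ f x} ∩
      WeakDual.toStrongDual ⁻¹' Metric.closedBall (0 : StrongDual ℝ A) 1 := by
    ext f
    simp [positiveDualBall]
  rw [h]
  refine (WeakDual.isCompact_closedBall _ _).inter_left ?_
  simp only [Set.ofPred_forall]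
  exact isClosed_iInter fun x => isClosed_iInter fun _ =>
    isClosed_le continuous_const (WeakDual.eval_continuous x)

theorem map_mul_of_forall_mem_posBall {f : StrongDual ℝ A}
    (h : ∀ b ∈ posBall A, ∀ z, f (z * b) = f z * f b) (z b : A) : f (z * b) = f z * f b := by
  have hpos : ∀ b, 0 ≤ b → f (z * b) = f z * f b := fun b hb => by
    have hn : 0 < ‖b‖ + 1 := by positivity
    have h1 := h ((‖b‖ + 1)⁻¹ • b) ⟨smul_nonneg (inv_nonneg.2 hn.le) hb, by
      rw [norm_smul, norm_inv, Real.norm_of_nonneg hn.le, inv_mul_le_iff₀ hn]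
      linarith⟩ z
    rw [mul_smul_comm, map_smul, map_smul, smul_eq_mul, smul_eq_mul, mul_left_comm] at h1
    exact mul_left_cancel₀ (inv_ne_zero hn.ne') h1
  conv_lhs => rw [← posPart_sub_negPart b]
  rw [mul_sub, map_sub, hpos _ (posPart_nonneg b), hpos _ (negPart_nonneg b), ← mul_sub,
    ← map_sub, posPart_sub_negPart]

/-- Extreme points of the positive part of the dual unit ball are multiplicative. -/
theorem map_mul_of_mem_extremePoints {f : WeakDual ℝ A}
    (hf : f ∈ Set.extremePoints ℝ (positiveDualBall A)) (a b : A) : f (a * b) = f a * f b := by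
  obtain ⟨⟨hpos, hf1⟩, hext⟩ := mem_extremePoints_iff_left.1 hf
  set F : StrongDual ℝ A := WeakDual.toStrongDual f with hF
  refine map_mul_of_forall_mem_posBall (f := F) (fun b hb z => ?_) a b
  have hg := norm_mulRightDual (f := F) hpos hb.1
  have hh := norm_sub_mulRightDual (f := F) hpos hb
  have hgpos := mulRightDual_positive (f := F) hpos hb.1
  have hhpos := sub_mulRightDual_positive (f := F) hpos hb
  have ht0 : 0 ≤ F b := hpos b hb.1
  have ht1 : F b ≤ 1 := by linarith [norm_nonneg (F - mulRightDual F b)]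
  set t := F b
  rcases ht0.eq_or_lt with h | ht0
  · rw [← h, norm_eq_zero] at hg
    rw [← mulRightDual_apply, hg, ← h]
    simp
  rcases ht1.eq_or_lt with h | ht1
  · have h0 : ‖F - mulRightDual F b‖ = 0 :=
      le_antisymm (by linarith) (norm_nonneg _)
    rw [norm_eq_zero, sub_eq_zero] at h0
    rw [h, mul_one, ← mulRightDual_apply, ← h0]
  have hs0 : 0 < 1 - t := by linarith
  -- For 0 < t < 1, f is the convex combination with weights t and 1 - t of the two rescaled
  -- summands. The second has norm at most one because ‖f‖ - t ≤ 1 - t. Extremality then makes the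
  -- first equal to f.
  have key := hext (StrongDual.toWeakDual (t⁻¹ • mulRightDual F b))
    ⟨fun x hx => mul_nonneg (inv_nonneg.2 ht0.le) (hgpos x hx), by
      rw [StrongDual.toStrongDual_toWeakDual, norm_smul, hg, norm_inv,
        Real.norm_of_nonneg ht0.le, inv_mul_cancel₀ ht0.ne']⟩
    (StrongDual.toWeakDual ((1 - t)⁻¹ • (F - mulRightDual F b)))
    ⟨fun x hx => mul_nonneg (inv_nonneg.2 hs0.le) (hhpos x hx), by
      rw [StrongDual.toStrongDual_toWeakDual, norm_smul, hh, norm_inv,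
        Real.norm_of_nonneg hs0.le, inv_mul_le_iff₀ hs0]
      linarith⟩
    ⟨t, 1 - t, ht0, hs0, by ring, by
      rw [← map_smul, ← map_smul, ← map_add, smul_inv_smul₀ ht0.ne', smul_inv_smul₀ hs0.ne',
        add_sub_cancel]
      rfl⟩
  have h := DFunLike.congr_fun key z
  change t⁻¹ * F (z * b) = F z at h
  rw [inv_mul_eq_iff_eq_mul₀ ht0.ne'] at h
  rw [h, mul_comm]

/-- By Krein–Milman the bound need only hold at extreme points. These are norm-one lattice
homomorphisms or 0, and `hc` covers 0. -/
theorem le_of_forall_latticeHom_le {y : A} {c : ℝ} (hc : 0 ≤ c)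
    (h : ∀ u : StrongDual ℝ A, PreservesLattice u → ‖u‖ = 1 → u y ≤ c) {f : StrongDual ℝ A}
    (hf : ∀ x, 0 ≤ x → 0 ≤ f x) (hf1 : ‖f‖ ≤ 1) : f y ≤ c := by
  have hmem : StrongDual.toWeakDual f ∈ positiveDualBall A := ⟨hf, hf1⟩
  have : LocallyConvexSpace ℝ (WeakDual ℝ A) :=
    inferInstanceAs (LocallyConvexSpace ℝ (WeakBilin (topDualPairing ℝ A)))
  rw [← closure_convexHull_extremePoints isCompact_positiveDualBall
    convex_positiveDualBall] at hmem
  let H : Set (WeakDual ℝ A) := {g | g y ≤ c}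
  have hclosed : IsClosed H := isClosed_le (WeakDual.eval_continuous y) continuous_const
  have hconv : Convex ℝ H := by
    intro g hg k hk s t hs ht hst
    exact (convex_Iic c) hg hk hs ht hst
  refine closure_minimal (convexHull_min (fun g hg => ?_) hconv) hclosed hmem
  have hmul := map_mul_of_mem_extremePoints hg
  have hpos := hg.1.1
  rcases norm_eq_zero_or_one_of_positive_of_mul (f := WeakDual.toStrongDual g) hpos hmul with h0 | h1
  · have : g y = 0 := DFunLike.congr_fun h0 y
    exact this.le.trans hc
  · exact h _ (preservesLattice_of_positive_of_mul
      (f := (WeakDual.toStrongDual g : A →ₗ[ℝ] ℝ)) hpos hmul) h1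

/-- The lattice homomorphisms of norm one separate points. -/
theorem eq_of_forall_latticeHom {x y : A}
    (h : ∀ u : StrongDual ℝ A, PreservesLattice u → ‖u‖ = 1 → u x = u y) : x = y := by
  have key : ∀ x y : A, (∀ u : StrongDual ℝ A, PreservesLattice u → ‖u‖ = 1 → u x = u y) →
      x ≤ y := fun x y h => by
    refine sub_nonneg.1 (nonneg_of_forall_positive fun f hf => ?_)
    have hn : 0 < ‖f‖ + 1 := by positivity
    have h1 := le_of_forall_latticeHom_le (y := x - y) le_rfl
      (fun u hu hu1 => by rw [map_sub, h u hu hu1, sub_self]) (f := (‖f‖ + 1)⁻¹ • f)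
      (fun z hz => mul_nonneg (inv_nonneg.2 hn.le) (hf z hz)) (by
        rw [norm_smul, norm_inv, Real.norm_of_nonneg hn.le, inv_mul_le_iff₀ hn]
        linarith)
    rw [smul_apply, smul_eq_mul, inv_mul_le_iff₀ hn, mul_zero, map_sub] at h1
    rw [map_sub]
    linarith
  exact le_antisymm (key x y h) (key y x fun u hu hu1 => (h u hu hu1).symm)

theorem norm_le_of_forall_latticeHom {y : A} {c : ℝ} (hc : 0 ≤ c)
    (h : ∀ u : StrongDual ℝ A, PreservesLattice u → ‖u‖ = 1 → |u y| ≤ c) : ‖y‖ ≤ c := by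
  rw [← norm_abs_eq_norm]
  refine norm_le_of_forall_positive (abs_nonneg y) fun f hf hf1 =>
    le_of_forall_latticeHom_le hc (fun u hu hu1 => ?_) hf hf1
  have := PreservesLattice.map_abs (f := (u : A →ₗ[ℝ] ℝ)) hu y
  exact this.trans_le (h u hu hu1)

end PositiveStates

/-! ### Automatic contractivity and positivity of characters. -/

section Characters

variable {A : Type u} [NonUnitalNormedRing A] [NormedSpace ℝ A]

/-- Characters of a Banach algebra are contractive. -/
theorem abs_apply_le_norm_of_mul [CompleteSpace A] [IsScalarTower ℝ A A] {χ : A →ₗ[ℝ] ℝ}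
    (hχ : ∀ a b, χ (a * b) = χ a * χ b) (x : A) : |χ x| ≤ ‖x‖ := by
  by_contra! hx
  have h0 : 0 < |χ x| := (norm_nonneg x).trans_lt hx
  have hne : χ x ≠ 0 := abs_pos.1 h0
  set a := (χ x)⁻¹ • x with ha_def
  have ha : ‖a‖ < 1 := by
    rwa [ha_def, norm_smul, norm_inv, Real.norm_eq_abs, inv_mul_lt_iff₀ h0, mul_one]
  have hχa : χ a = 1 := by rw [ha_def, map_smul, smul_eq_mul, inv_mul_cancel₀ hne]
  -- A fixed point b = a + ab would give χ(b) = 1 + χ(b).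
  have hcontr : ContractingWith ‖a‖₊ fun b => a + a * b :=
    ⟨by exact_mod_cast ha, LipschitzWith.of_dist_le_mul fun b c => by
      rw [dist_eq_norm, dist_eq_norm, add_sub_add_left_eq_sub, ← mul_sub]
      exact norm_mul_le _ _⟩
  have hfix := congrArg χ hcontr.fixedPoint_isFixedPt.eq
  rw [map_add, hχ, hχa] at hfix
  linarith

variable [Lattice A] [IsAMAlgebra A]

/-- Characters of an AM-algebra are positive. -/
theorem nonneg_of_mul {χ : A →ₗ[ℝ] ℝ} (hχ : ∀ a b, χ (a * b) = χ a * χ b) (x : A) (hx : 0 ≤ x) :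
    0 ≤ χ x := by
  have key : ∀ a ∈ posBall A, 0 ≤ χ a := fun a ha => by
    -- The iterates of w ↦ w - aw started at `a` stay in the positive ball. If χ(a) < 0, their
    -- values under χ are unbounded by Bernoulli, contradicting contractivity.
    have hw : ∀ n : ℕ, ∃ w ∈ posBall A, χ w = χ a * (1 - χ a) ^ n := fun n => by
      induction n with
      | zero => exact ⟨a, ha, by simp⟩
      | succ n ih =>
        obtain ⟨w, hw, hχw⟩ := ih
        have h0 : 0 ≤ w - a * w := sub_nonneg.2 (mul_le_right_of_mem_posBall ha hw.1)
        refine ⟨w - a * w, ⟨h0, (norm_le_norm_of_nonneg_of_le h0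
          (sub_le_self _ (amAlgebra_mul_nonneg ha.1 hw.1))).trans hw.2⟩, ?_⟩
        rw [map_sub, hχ, hχw]
        ring
    by_contra! hneg
    obtain ⟨n, hn⟩ := exists_nat_gt (1 / (χ a * χ a))
    obtain ⟨w, hw, hχw⟩ := hw n
    have h1 := (abs_apply_le_norm_of_mul hχ w).trans hw.2
    rw [hχw] at h1
    have h2 := one_add_mul_le_pow (a := -χ a) (by linarith) n
    rw [← sub_eq_add_neg 1 (χ a)] at h2
    have h3 := (abs_le.1 h1).1
    have h4 := mul_le_mul_of_nonpos_left h2 hneg.le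
    rw [div_lt_iff₀ (mul_pos_of_neg_of_neg hneg hneg)] at hn
    nlinarith
  have hn : 0 < ‖x‖ + 1 := by positivity
  have h := key ((‖x‖ + 1)⁻¹ • x) ⟨smul_nonneg (inv_nonneg.2 hn.le) hx, by
    rw [norm_smul, norm_inv, Real.norm_of_nonneg hn.le, inv_mul_le_iff₀ hn]
    linarith⟩
  rw [map_smul, smul_eq_mul] at h
  exact nonneg_of_mul_nonneg_right h (inv_pos.2 hn)

end Characters

/-! ### The equivalences for operators between AM-algebras. -/

section Homomorphisms

variable {X : Type u} [NonUnitalNormedRing X] [NormedSpace ℝ X] [Lattice X] [IsAMAlgebra X]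
  {Y : Type v} [NonUnitalNormedRing Y] [NormedSpace ℝ Y] [Lattice Y] [IsAMAlgebra Y]
  {T : X →ₗ[ℝ] Y}

theorem mul_comp_latticeHom (hT : ∀ a b, T (a * b) = T a * T b) {u : StrongDual ℝ Y}
    (hu : PreservesLattice u) (hu1 : ‖u‖ = 1) (a b : X) :
    ((u : Y →ₗ[ℝ] ℝ) ∘ₗ T) (a * b) = ((u : Y →ₗ[ℝ] ℝ) ∘ₗ T) a * ((u : Y →ₗ[ℝ] ℝ) ∘ₗ T) b := by
  change u (T (a * b)) = u (T a) * u (T b)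
  rw [hT, map_mul_of_preservesLattice hu hu1]

theorem norm_map_le_of_mul (hT : ∀ a b, T (a * b) = T a * T b) (x : X) : ‖T x‖ ≤ ‖x‖ :=
  norm_le_of_forall_latticeHom (norm_nonneg x) fun _ hu hu1 =>
    abs_apply_le_norm_of_mul (mul_comp_latticeHom hT hu hu1) x

theorem preservesLattice_comp_of_mul (hT : ∀ a b, T (a * b) = T a * T b) {u : StrongDual ℝ Y}
    (hu : PreservesLattice u) (hu1 : ‖u‖ = 1) : PreservesLattice ((u : Y →ₗ[ℝ] ℝ) ∘ₗ T) :=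
  preservesLattice_of_positive_of_mul (nonneg_of_mul (mul_comp_latticeHom hT hu hu1))
    (mul_comp_latticeHom hT hu hu1)

/-- Algebra homomorphisms between AM-algebras are lattice homomorphisms. -/
theorem preservesLattice_of_mul (hT : ∀ a b, T (a * b) = T a * T b) : PreservesLattice T :=
  fun a b => ⟨eq_of_forall_latticeHom fun _ hu hu1 =>
      ((preservesLattice_comp_of_mul hT hu hu1 a b).1).trans (hu (T a) (T b)).1.symm,
    eq_of_forall_latticeHom fun _ hu hu1 =>
      ((preservesLattice_comp_of_mul hT hu hu1 a b).2).trans (hu (T a) (T b)).2.symm⟩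

theorem hasLimAlong_of_isLUB {E : Type*} [NormedAddCommGroup E] [NormedSpace ℝ E] [Lattice E]
    [IsOrderedAddMonoid E] [IsOrderedModule ℝ E] [HasSolidNorm E]
    {g : StrongDual ℝ E} (hg : ∀ x, 0 ≤ x → 0 ≤ g x) {B : Set E} {l : ℝ}
    (h : IsLUB (g '' B) l) : HasLimAlong B g l := by
  refine tendsto_atTop_isLUB (fun x y hxy => ?_) ?_
  · exact map_mono_of_positive (f := (g : E →ₗ[ℝ] ℝ)) hg hxy
  · rwa [← Set.image_eq_range]

/-- The supremum is taken in two stages: over `a` it gives ‖f(· b)‖ = f(b), then over `b` it gives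
‖f‖. -/
theorem isLUB_image_setSq_posBall {f : StrongDual ℝ X} (hf : ∀ x, 0 ≤ x → 0 ≤ f x) :
    IsLUB (f '' setSq (posBall X)) ‖f‖ := by
  constructor
  · rintro _ ⟨_, ⟨a, ha, b, hb, rfl⟩, rfl⟩
    exact (isLUB_image_posBall hf).1 ⟨_, mul_mem_posBall ha hb, rfl⟩
  · intro c hc
    refine (isLUB_image_posBall hf).2 ?_
    rintro _ ⟨b, hb, rfl⟩
    rw [← norm_mulRightDual hf hb.1]
    refine (isLUB_image_posBall (mulRightDual_positive hf hb.1)).2 ?_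
    rintro _ ⟨a, ha, rfl⟩
    exact hc ⟨a * b, ⟨a, ha, b, hb, rfl⟩, rfl⟩

theorem setSq_image_of_mul (hT : ∀ a b, T (a * b) = T a * T b) (B : Set X) :
    setSq (T '' B) = T '' setSq B := by
  ext z
  constructor
  · rintro ⟨_, ⟨a, ha, rfl⟩, _, ⟨b, hb, rfl⟩, rfl⟩
    exact ⟨a * b, ⟨a, ha, b, hb, rfl⟩, hT a b⟩
  · rintro ⟨_, ⟨a, ha, b, hb, rfl⟩, rfl⟩
    exact ⟨_, ⟨a, ha, rfl⟩, _, ⟨b, hb, rfl⟩, hT a b⟩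

theorem exists_hasLimAlong_of_mul (hT : ∀ a b, T (a * b) = T a * T b) (g : StrongDual ℝ Y) :
    ∃ l : ℝ, HasLimAlong (setSq (T '' posBall X)) g l ∧ HasLimAlong (T '' posBall X) g l := by
  let T' : X →L[ℝ] Y := T.mkContinuous 1 fun x => by
    rw [one_mul]
    exact norm_map_le_of_mul hT x
  have hpos : ∀ g : StrongDual ℝ Y, (∀ y, 0 ≤ y → 0 ≤ g y) →
      HasLimAlong (setSq (T '' posBall X)) g ‖g.comp T'‖ ∧
        HasLimAlong (T '' posBall X) g ‖g.comp T'‖ := fun g hg => by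
    have hgT : ∀ x, 0 ≤ x → 0 ≤ g.comp T' x := fun x hx =>
      hg _ ((preservesLattice_of_mul hT).nonneg x hx)
    constructor
    · refine hasLimAlong_of_isLUB hg ?_
      rw [setSq_image_of_mul hT, Set.image_image]
      exact isLUB_image_setSq_posBall hgT
    · refine hasLimAlong_of_isLUB hg ?_
      rw [Set.image_image]
      exact isLUB_image_posBall hgT
  obtain ⟨g₁, g₂, hg₁, hg₂, rfl⟩ := exists_positive_sub_positive g
  exact ⟨_, (hpos g₁ hg₁).1.sub (hpos g₂ hg₂).1, (hpos g₁ hg₁).2.sub (hpos g₂ hg₂).2⟩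

theorem isLUB_of_hasLimAlong {E : Type*} [NormedAddCommGroup E] [NormedSpace ℝ E] [Lattice E]
    [IsOrderedAddMonoid E] [IsOrderedModule ℝ E] [HasSolidNorm E]
    {g : StrongDual ℝ E} (hg : ∀ x, 0 ≤ x → 0 ≤ g x) {B : Set E} {l : ℝ}
    (hB : B.Nonempty) (hdir : DirectedOn (· ≤ ·) B) (h : HasLimAlong B g l) :
    IsLUB (g '' B) l := by
  have : Nonempty B := hB.to_subtype
  have : IsDirectedOrder B := ⟨fun a b => by
    obtain ⟨c, hc, hac, hbc⟩ := hdir a a.2 b b.2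
    exact ⟨⟨c, hc⟩, hac, hbc⟩⟩
  rw [Set.image_eq_range]
  refine isLUB_of_tendsto_atTop (fun x y hxy => ?_) h
  exact map_mono_of_positive (f := (g : E →ₗ[ℝ] ℝ)) hg hxy

/-- A lattice homomorphism for which the limits along the positive part of the unit ball and its
square coincide is multiplicative. -/
theorem mul_of_hasLimAlong (hT : PreservesLattice T)
    (hlim : ∀ g : StrongDual ℝ Y, ∃ l : ℝ,
      HasLimAlong (setSq (T '' posBall X)) g l ∧ HasLimAlong (T '' posBall X) g l) (a b : X) :
    T (a * b) = T a * T b := by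
  refine eq_of_forall_latticeHom fun u hu hu1 => ?_
  rw [map_mul_of_preservesLattice hu hu1]
  have hupos : ∀ y, 0 ≤ y → 0 ≤ u y := PreservesLattice.nonneg (f := (u : Y →ₗ[ℝ] ℝ)) hu
  obtain ⟨l, hl2, hl1⟩ := hlim u
  have h0 : (0 : X) ∈ posBall X := ⟨le_rfl, by simp⟩
  have hmono : ∀ {x y : X}, x ≤ y → T x ≤ T y := fun {x y} hxy => by
    have := hT.nonneg _ (sub_nonneg.2 hxy)
    rwa [map_sub, sub_nonneg] at this
  have hdir₁ : DirectedOn (· ≤ ·) (T '' posBall X) := by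
    rintro _ ⟨x, hx, rfl⟩ _ ⟨y, hy, rfl⟩
    exact ⟨_, ⟨x ⊔ y, sup_mem_posBall hx hy, rfl⟩, hmono le_sup_left, hmono le_sup_right⟩
  have hL1 := isLUB_of_hasLimAlong hupos (Set.Nonempty.image T ⟨0, h0⟩) hdir₁ hl1
  have hdir : DirectedOn (· ≤ ·) (setSq (T '' posBall X)) := by
    rintro _ ⟨_, ⟨x, hx, rfl⟩, _, ⟨y, hy, rfl⟩, rfl⟩ _ ⟨_, ⟨z, hz, rfl⟩, _, ⟨w, hw, rfl⟩, rfl⟩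
    exact ⟨_, ⟨_, ⟨x ⊔ z, sup_mem_posBall hx hz, rfl⟩, _, ⟨y ⊔ w, sup_mem_posBall hy hw, rfl⟩,
      rfl⟩, amAlgebra_mul_le_mul (hmono le_sup_left) (hmono le_sup_left) (hT.nonneg _ hy.1)
        (hT.nonneg _ (hx.1.trans le_sup_left)),
      amAlgebra_mul_le_mul (hmono le_sup_right) (hmono le_sup_right) (hT.nonneg _ hw.1)
        (hT.nonneg _ (hx.1.trans le_sup_left))⟩
  have hne : (setSq (T '' posBall X)).Nonempty :=
    ⟨_, T 0, ⟨0, h0, rfl⟩, T 0, ⟨0, h0, rfl⟩, rfl⟩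
  have hL2 := isLUB_of_hasLimAlong hupos hne hdir hl2
  have hl0 : 0 ≤ l := by
    have := hL1.1 ⟨T 0, ⟨0, h0, rfl⟩, rfl⟩
    simpa using this
  have hub : ∀ x ∈ posBall X, u (T x) ≤ l := fun x hx => hL1.1 ⟨T x, ⟨x, hx, rfl⟩, rfl⟩
  -- As u is multiplicative and the values are nonnegative, the supremum of u over the square set is
  -- the square of its supremum over T((B_X)_+).
  have hsq : l = l * l := by
    apply le_antisymm
    · refine hL2.2 ?_
      rintro _ ⟨_, ⟨_, ⟨x, hx, rfl⟩, _, ⟨y, hy, rfl⟩, rfl⟩, rfl⟩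
      rw [map_mul_of_preservesLattice hu hu1]
      exact mul_le_mul (hub x hx) (hub y hy) (hupos _ (hT.nonneg _ hy.1)) hl0
    · have h1 : ∀ x ∈ posBall X, u (T x) * u (T x) ≤ l := fun x hx => by
        rw [← map_mul_of_preservesLattice hu hu1]
        exact hL2.1 ⟨_, ⟨_, ⟨x, hx, rfl⟩, _, ⟨x, hx, rfl⟩, rfl⟩, rfl⟩
      rw [← sq, ← Real.le_sqrt hl0 hl0]
      refine hL1.2 ?_
      rintro _ ⟨_, ⟨x, hx, rfl⟩, rfl⟩
      exact Real.le_sqrt_of_sq_le (by rw [sq]; exact h1 x hx)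
  -- T is not assumed bounded; the finite limit `l` supplies the continuity of u ∘ T.
  have hbound : ∀ x, ‖((u : Y →ₗ[ℝ] ℝ) ∘ₗ T) x‖ ≤ l * ‖x‖ := fun x => by
    rcases eq_or_ne x 0 with rfl | hx0
    · simp
    have hn : 0 < ‖x‖ := norm_pos_iff.2 hx0
    have h := hub (‖x‖⁻¹ • |x|) ⟨smul_nonneg (inv_nonneg.2 hn.le) (abs_nonneg x), by
      rw [norm_smul, norm_abs_eq_norm, norm_inv, norm_norm, inv_mul_cancel₀ hn.ne']⟩
    rw [map_smul, map_smul, smul_eq_mul, inv_mul_le_iff₀ hn, hT.map_abs] at h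
    have h2 := PreservesLattice.map_abs (f := (u : Y →ₗ[ℝ] ℝ)) hu (T x)
    rw [Real.norm_eq_abs]
    change u |T x| = |u (T x)| at h2
    change |u (T x)| ≤ _
    linarith
  let χ : StrongDual ℝ X := ((u : Y →ₗ[ℝ] ℝ) ∘ₗ T).mkContinuous l hbound
  have hχ : PreservesLattice χ := fun x y => by
    change u (T _) = u (T x) ⊔ u (T y) ∧ u (T _) = u (T x) ⊓ u (T y)
    rw [(hT x y).1, (hT x y).2]
    exact hu _ _
  have hχn : ‖χ‖ = l := by
    have h1 := isLUB_image_posBall (f := χ) (PreservesLattice.nonneg (f := (χ : X →ₗ[ℝ] ℝ)) hχ)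
    refine h1.unique ?_
    rw [Set.image_image] at hL1
    exact hL1
  have hl01 : l = 0 ∨ l = 1 := by
    have : l * (l - 1) = 0 := by linarith
    rcases mul_eq_zero.1 this with h | h
    · exact Or.inl h
    · exact Or.inr (by linarith)
  change χ (a * b) = χ a * χ b
  rcases hl01 with h | h
  · rw [h, norm_eq_zero] at hχn
    simp [hχn]
  · exact map_mul_of_preservesLattice hχ (hχn.trans h) a b

/-- The composition of an element of `KSet Y` with an algebra homomorphism is in `KSet X`. -/
theorem comp_mem_KSet_of_mul {T : X →L[ℝ] Y} (hT : ∀ a b, T (a * b) = T a * T b)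
    (h : KSet Y) :
    StrongDual.toWeakDual ((WeakDual.toStrongDual (h : WeakDual ℝ Y)).comp T) ∈ KSet X := by
  have hTl := preservesLattice_of_mul (T := (T : X →ₗ[ℝ] Y)) hT
  have hT1 : ‖T‖ ≤ 1 := T.opNorm_le_bound zero_le_one fun x => by
    rw [one_mul]
    exact norm_map_le_of_mul (T := (T : X →ₗ[ℝ] Y)) hT x
  refine ⟨fun a b => ?_, ?_⟩
  · have h1 := h.2.1 (T a) (T b)
    have h2 := hTl a b
    change (h : WeakDual ℝ Y) (T _) = _ ∧ (h : WeakDual ℝ Y) (T _) = _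
    change T _ = T a ⊔ T b ∧ T _ = T a ⊓ T b at h2
    rw [h2.1, h2.2]
    exact h1
  · rw [StrongDual.toStrongDual_toWeakDual]
    exact (ContinuousLinearMap.opNorm_comp_le _ _).trans
      (mul_le_one₀ h.2.2 (norm_nonneg _) hT1)

/-- Algebra homomorphisms are composition operators. -/
theorem exists_composition_of_mul (hT : ∀ a b, T (a * b) = T a * T b) :
    ∃ φ : KSet Y → KSet X, Continuous φ ∧ IsPosHomMap φ ∧
      (∀ g ∈ KOne Y, φ g ∈ KOne X ∨ (φ g : WeakDual ℝ X) = 0) ∧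
      ∀ x : X, ((ev (T x) : Cph Y) : KSet Y → ℝ) = ((ev x : Cph X) : KSet X → ℝ) ∘ φ := by
  let T' : X →L[ℝ] Y := T.mkContinuous 1 fun x => by
    rw [one_mul]
    exact norm_map_le_of_mul hT x
  have hT' : ∀ a b, T' (a * b) = T' a * T' b := hT
  refine ⟨fun h => ⟨_, comp_mem_KSet_of_mul hT' h⟩, ?_, ?_, ?_, ?_⟩
  · refine Continuous.subtype_mk (WeakDual.continuous_of_continuous_eval fun x => ?_) _
    exact (WeakDual.eval_continuous (T x)).comp continuous_subtype_val
  · intro f _ c _ _ h hh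
    refine DFunLike.ext _ _ fun x => ?_
    change (h : WeakDual ℝ Y) (T x) = c * (f : WeakDual ℝ Y) (T x)
    rw [hh]
    rfl
  · intro g hg
    have hmul := mul_comp_latticeHom hT (u := WeakDual.toStrongDual (g : WeakDual ℝ Y)) g.2.1 hg
    rcases norm_eq_zero_or_one_of_positive_of_mul
      (f := (WeakDual.toStrongDual (g : WeakDual ℝ Y)).comp T')
      (nonneg_of_mul hmul) hmul with h | h
    · right
      refine DFunLike.ext _ _ fun x => ?_
      exact DFunLike.congr_fun h x
    · exact Or.inl h
  · intro x
    rfl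

/-- Composition operators are multiplicative. -/
theorem mul_of_composition {φ : KSet Y → KSet X}
    (hφ : ∀ g ∈ KOne Y, φ g ∈ KOne X ∨ (φ g : WeakDual ℝ X) = 0)
    (hTφ : ∀ x : X, ((ev (T x) : Cph Y) : KSet Y → ℝ) = ((ev x : Cph X) : KSet X → ℝ) ∘ φ)
    (a b : X) : T (a * b) = T a * T b := by
  refine eq_of_forall_latticeHom fun u hu hu1 => ?_
  rw [map_mul_of_preservesLattice hu hu1]
  let g : KSet Y := ⟨StrongDual.toWeakDual u, hu, hu1.le⟩
  have hev : ∀ x, u (T x) = (φ g : WeakDual ℝ X) x := fun x => congrFun (hTφ x) g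
  rw [hev, hev, hev]
  rcases hφ g hu1 with h | h
  · exact map_mul_of_preservesLattice
      (f := WeakDual.toStrongDual (φ g : WeakDual ℝ X)) (φ g).2.1 h a b
  · rw [h]
    exact (mul_zero _).symm

end Homomorphisms

theorem theorem4p3
    {X : Type u} [NonUnitalNormedRing X] [NormedSpace ℝ X] [Lattice X] [IsAMAlgebra X]
    {Y : Type v} [NonUnitalNormedRing Y] [NormedSpace ℝ Y] [Lattice Y] [IsAMAlgebra Y]
    (T : X →ₗ[ℝ] Y) :
    List.TFAE
      [ -- `T` is an algebra homomorphism
        ∀ a b : X, T (a * b) = T a * T b,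
        -- `T` is a lattice homomorphism, and the two limits exist and coincide
        PreservesLattice T ∧
          ∀ g : StrongDual ℝ Y, ∃ l : ℝ,
            HasLimAlong (setSq (T '' posBall X)) g l ∧ HasLimAlong (T '' posBall X) g l,
        -- `T` is composition with `φ`, after identifying `X` and `Y` with `Cph X` and `Cph Y`
        ∃ φ : KSet Y → KSet X, Continuous φ ∧ IsPosHomMap φ ∧
          (∀ g ∈ KOne Y, φ g ∈ KOne X ∨ (φ g : WeakDual ℝ X) = 0) ∧
          ∀ x : X, ((ev (T x) : Cph Y) : KSet Y → ℝ) = ((ev x : Cph X) : KSet X → ℝ) ∘ φ ] := by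
  tfae_have 1 → 2 := fun h => ⟨preservesLattice_of_mul h, exists_hasLimAlong_of_mul h⟩
  tfae_have 2 → 1 := fun h => mul_of_hasLimAlong h.1 h.2
  tfae_have 1 → 3 := exists_composition_of_mul
  tfae_have 3 → 1 := fun ⟨_, _, _, hφ, hT⟩ => mul_of_composition hφ hT
  tfae_finish
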